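/- Let $[m]=\{1,\dots,m\}$. A combinatorial line in $[m]^n$ is given by a word $\ell\in([m]\cup\{\star\})^n$ containing at least one $\star$, and consists of the $m$ words $\ell[1],\dots,\ell[m]$, where $\ell[\alpha]$ is obtained from $\ell$ by replacing every $\star$ by $\alpha$; the coordinates at which $\ell$ has a $\star$ are called active. The line is $q$-fold if its set of active coordinates is the union of at most $q$ intervals of $\{1,\dots,n\}$. Let $\mathcal I(m,r)$ be the least positive integer $q$ such that, for all sufficiently large $n$, every $r$-colouring of $[m]^n$ contains a monochromatic $q$-fold combinatorial line. Theorem. For every even $r\ge 2$ there is an $N=N(r)$ such that, for all $n\ge N$, every $r$-colouring of $[3]^n$ contains a monochromatic combinatorial line whose set of active coordinates is the union of at most $r-1$ intervals. Moreover, $\mathcal I(3,r)=r-1$ for every even $r\ge 2$. -/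

import Mathlib

namespace HalesJewettIntervals

/-- The set of active (wildcard) coordinates of a combinatorial line in `[m]^n`. -/
def activeSet {m n : ℕ} (l : Combinatorics.Line (Fin m) (Fin n)) : Set (Fin n) :=
  {i | l.idxFun i = none}

/-- A combinatorial line is `q`-fold if its set of active coordinates is the union of at most `q`
intervals of `{1, …, n}`. (The `q` intervals may coincide, overlap or be empty, hence
"at most `q`".) -/
def IsFold {m n : ℕ} (q : ℕ) (l : Combinatorics.Line (Fin m) (Fin n)) : Prop :=
  ∃ a b : Fin q → Fin n, activeSet l = ⋃ j, Set.Icc (a j) (b j)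

/-- Every `r`-colouring of `[m]^n` contains a monochromatic `q`-fold combinatorial line. -/
def ForcesFoldLine (m r q n : ℕ) : Prop :=
  ∀ C : (Fin n → Fin m) → Fin r,
    ∃ l : Combinatorics.Line (Fin m) (Fin n), l.IsMono C ∧ IsFold q l

/-- `I(m, r) = q`: the number `q` is the least positive integer such that, for all sufficiently
large `n`, every `r`-colouring of `[m]^n` contains a monochromatic `q`-fold combinatorial line. -/
def IsIntervalNumber (m r q : ℕ) : Prop :=
  IsLeast {p : ℕ | 0 < p ∧ ∃ N : ℕ, ∀ n : ℕ, N ≤ n → ForcesFoldLine m r p n} q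

end HalesJewettIntervals

/-!
Fewer than `r - 1` intervals do not suffice, because `r - 1` is odd: give the three letters the
values `0, 1, -1` and colour a word by `∑ xᵢ (xᵢ - xᵢ₋₁)` modulo `r - 1`. Along a line this is a
quadratic polynomial in the letter value, whose leading coefficient is the number of components of
the active set (`wordForm_second_difference`). On a monochromatic line twice this number vanishes
modulo the odd number `r - 1`.

For the upper bound suppose that there are colourings without a suitable line for arbitrarily large
`n`. Letting the block boundaries of a word and then `n` tend to infinity along an ultrafilter
gives a colouring `limitColour` of abstract lists of letters, one letter for each block. It does not
change when equal neighbouring letters are merged, and no pattern with between `1` and `r - 1` stars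
is monochromatic for it (`limitColour_merge`, `limitColour_not_mono`).

A star between two different letters only matters when it is replaced by the third letter. Hence
inserting between `1` and `r - 1` copies of a letter `i` at places between the two other letters
changes the colour. Two words which both differ in this way from the same `r - 1` words of distinct
colours have the same colour; therefore it does not matter at which places the copies of `i` are
inserted, and their number only matters modulo `r` (`colour_move`, `colour_reserve_period`). So the
colour becomes a function on `(ZMod r) ^ 3`, the coordinates counting the copies of each letter.
A star between two different letters translates by a unit vector for one of the letters. A star
between two letters `i` translates by `e i + e a` when replaced by `a ≠ i`.

The rest is the statement `exists_equal_colours` on `(ZMod r) ^ 3`. Let `X, Y, Z` be the distances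
from a point to a colour class along the axes, as numbers in `{1, …, r - 1}` off the class. The
stars between different letters give `r ≤ X + Y + Z`. Those between equal letters improve this to
`2 * r ≤ X + Y + Z` if one distance has sum at least `r` with both others. Passing to the opposite
corner of a rectangle replaces `X, Y` by `r - X, r - Y`, so the averages of the distances are known,
and comparison forces `X + Y + Z` to be `r` or `2 * r` everywhere (`sum_eq_or_eq`). Summing over a
line gives `3 * ∑ t = 0` in `ZMod r`, which fails for even `r`.
-/

namespace HalesJewettIntervals

/-! ### A colouring without lines of few intervals -/

section

open Finset

/-- The three letters as the numbers `0, 1, -1`. -/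
def letterValue (R : Type*) [Ring R] : Fin 3 → R := ![0, 1, -1]

/-- The letter values of a word, shifted by one and preceded (and followed) by zeros. -/
def paddedValue (R : Type*) [Ring R] {n : ℕ} (w : Fin n → Fin 3) : ℕ → R
  | 0 => 0
  | k + 1 => if h : k < n then letterValue R (w ⟨k, h⟩) else 0

/-- The quadratic form `∑ xᵢ (xᵢ - xᵢ₋₁)` in the letter values of a word, with `x₋₁ = 0`. -/
def wordForm (R : Type*) [Ring R] {n : ℕ} (w : Fin n → Fin 3) : R :=
  ∑ i ∈ range n, paddedValue R w (i + 1) * (paddedValue R w (i + 1) - paddedValue R w i)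

/-- The left endpoints of the components of a set of coordinates. -/
def leftEnds {n : ℕ} (s : Set (Fin n)) : Set (Fin n) :=
  {i | i ∈ s ∧ ∀ j : Fin n, (j : ℕ) + 1 = i → j ∉ s}

lemma leftEnds_subset_range {n q : ℕ} (a b : Fin q → Fin n) :
    leftEnds (⋃ j, Set.Icc (a j) (b j)) ⊆ Set.range a := by
  rintro i ⟨hi, hprev⟩
  obtain ⟨j, hj⟩ := Set.mem_iUnion.1 hi
  refine ⟨j, by_contra fun hne => ?_⟩
  have hlt : (a j : ℕ) < i := lt_of_le_of_ne hj.1 fun h => hne (Fin.ext h)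
  have hib : (i : ℕ) ≤ b j := hj.2
  refine hprev ⟨i - 1, by omega⟩ (by simp; omega) (Set.mem_iUnion.2 ⟨j, ?_, ?_⟩)
  · rw [Fin.le_def]; simp; omega
  · rw [Fin.le_def]; simp; omega

lemma leftEnds_nonempty {n : ℕ} {s : Set (Fin n)} (hs : s.Nonempty) : (leftEnds s).Nonempty := by
  obtain ⟨i, hi, hmin⟩ := s.toFinite.exists_minimal hs
  refine ⟨i, hi, fun j hj hjs => ?_⟩
  have := hmin hjs (by rw [Fin.le_def]; omega)
  rw [Fin.le_def] at this
  omega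

open Classical in
/-- Along a combinatorial line the quadratic form is a quadratic polynomial in the letter value,
whose leading coefficient counts the components of the active set. -/
lemma wordForm_second_difference (R : Type*) [CommRing R] {n : ℕ}
    (l : Combinatorics.Line (Fin 3) (Fin n)) :
    wordForm R (l 1) + wordForm R (l 2) - 2 * wordForm R (l 0) =
      2 * ((leftEnds (activeSet l)).ncard : R) := by
  set F : ℕ → R := paddedValue R (l 0) with hF
  let χ : ℕ → R := fun k => if ∃ i : Fin n, (i : ℕ) + 1 = k ∧ i ∈ activeSet l then 1 else 0
  have key : ∀ (t : Fin 3) (k : ℕ),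
      paddedValue R (l t) k = F k + letterValue R t * χ k := by
    intro t k
    rcases k with _ | k
    · simp [hF, paddedValue, χ]
    · by_cases hk : k < n
      · have hχ : χ (k + 1) = if l.idxFun ⟨k, hk⟩ = none then 1 else 0 := by
          simp only [χ, activeSet, Set.mem_ofPred_eq]
          congr 1
          apply propext
          constructor
          · rintro ⟨i, hi, h⟩
            have : i = ⟨k, hk⟩ := Fin.ext (by simpa using hi)
            exact this ▸ h
          · exact fun h => ⟨⟨k, hk⟩, rfl, h⟩
        rw [hχ]
        simp only [hF, paddedValue, hk, dif_pos, Combinatorics.Line.apply_def]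
        rcases h : l.idxFun ⟨k, hk⟩ with _ | a <;> simp [letterValue]
      · have hχ : χ (k + 1) = 0 := by
          simp only [χ]
          rw [if_neg]
          rintro ⟨i, hi, -⟩
          have := i.2
          omega
        simp [hF, paddedValue, hk, hχ]
  have hcard : ∑ i ∈ range n, χ (i + 1) * (χ (i + 1) - χ i)
      = ((leftEnds (activeSet l)).ncard : R) := by
    rw [Set.ncard_eq_toFinset_card', ← Fin.sum_univ_eq_sum_range
      (fun i => χ (i + 1) * (χ (i + 1) - χ i)), Finset.cast_card]
    symm
    refine Finset.sum_subset_zero_on_sdiff (subset_univ _) ?_ ?_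
    rotate_left
    · intro i hi
      obtain ⟨h1, h2⟩ := Set.mem_toFinset.1 hi
      have e1 : χ (i + 1) = 1 := if_pos ⟨i, rfl, h1⟩
      have e2 : χ i = 0 := if_neg (by rintro ⟨j, hj, h⟩; exact h2 j hj h)
      simp [e1, e2]
    · intro i hi
      replace hi : i ∉ leftEnds (activeSet l) := by simpa using hi
      by_cases h1 : i ∈ activeSet l
      · have e1 : χ (i + 1) = 1 := if_pos ⟨i, rfl, h1⟩
        have e2 : χ i = 1 := by
          refine if_pos ?_
          by_contra h
          push Not at h
          exact hi ⟨h1, h⟩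
        simp [e1, e2]
      · have e1 : χ (i + 1) = 0 := by
          refine if_neg ?_
          rintro ⟨j, hj, h⟩
          have : j = i := Fin.ext (by omega)
          exact h1 (this ▸ h)
        simp [e1]
  rw [← hcard]
  simp only [wordForm, key, Finset.mul_sum]
  rw [← Finset.sum_add_distrib, ← Finset.sum_sub_distrib]
  refine Finset.sum_congr rfl fun i _ => ?_
  simp only [letterValue, Matrix.cons_val_zero, Matrix.cons_val_one, Matrix.cons_val]
  ring

/-- Colouring by the quadratic form modulo an odd number `s` of colours (or more colours) avoids
monochromatic lines with fewer than `s` intervals. -/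
theorem not_forcesFoldLine {s r q n : ℕ} (hs : Odd s) (hsr : s ≤ r) (hq : q < s) :
    ¬ ForcesFoldLine 3 r q n := by
  intro h
  have : NeZero s := ⟨by omega⟩
  obtain ⟨l, ⟨c, hc⟩, a, b, hab⟩ :=
    h fun w => ⟨(wordForm (ZMod s) w).val, (ZMod.val_lt _).trans_le hsr⟩
  have heq : ∀ t, wordForm (ZMod s) (l t) = wordForm (ZMod s) (l 0) := fun t =>
    ZMod.val_injective s (by simpa using congrArg Fin.val ((hc t).trans (hc 0).symm))
  have h2 := wordForm_second_difference (ZMod s) l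
  rw [heq 1, heq 2, two_mul, sub_self] at h2
  have hdvd : s ∣ 2 * (leftEnds (activeSet l)).ncard := by
    rw [← ZMod.natCast_eq_zero_iff]; push_cast; exact h2.symm
  have hdvd' := (Nat.Coprime.dvd_of_dvd_mul_left (by simpa using hs) hdvd)
  have hpos : 0 < (leftEnds (activeSet l)).ncard := by
    rw [Set.ncard_pos (Set.toFinite _)]
    exact leftEnds_nonempty l.proper
  have hle : (leftEnds (activeSet l)).ncard ≤ q := by
    rw [hab]
    refine (Set.ncard_le_ncard (leftEnds_subset_range a b) (Set.toFinite _)).trans ?_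
    rw [← Set.image_univ]
    refine (Set.ncard_image_le (Set.toFinite _)).trans ?_
    simp [Set.ncard_univ]
  have := Nat.le_of_dvd hpos hdvd'
  omega

end

/-! ### Limit colours along an ultrafilter -/

section

open Filter

/-- The constant value that a colour sequence takes along an ultrafilter. -/
lemma exists_eventually_eq {r : ℕ} (U : Ultrafilter ℕ) (g : ℕ → Fin r) :
    ∃ c, ∀ᶠ n in U, g n = c := by
  have h : ∀ᶠ n in (U : Filter ℕ), ∃ c ∈ (Set.univ : Set (Fin r)), g n = c :=
    Eventually.of_forall fun n => ⟨g n, trivial, rfl⟩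
  obtain ⟨c, -, hc⟩ := (Ultrafilter.eventually_exists_mem_iff Set.finite_univ).1 h
  exact ⟨c, hc⟩

/-- The limit of a colour sequence along an ultrafilter. -/
noncomputable def colourLim {r : ℕ} (U : Ultrafilter ℕ) (g : ℕ → Fin r) : Fin r :=
  (exists_eventually_eq U g).choose

lemma eventually_eq_colourLim {r : ℕ} (U : Ultrafilter ℕ) (g : ℕ → Fin r) :
    ∀ᶠ n in U, g n = colourLim U g :=
  (exists_eventually_eq U g).choose_spec

lemma colourLim_eq {r : ℕ} {U : Ultrafilter ℕ} {g : ℕ → Fin r} {c : Fin r}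
    (h : ∀ᶠ n in U, g n = c) : colourLim U g = c := by
  obtain ⟨n, h1, h2⟩ := ((eventually_eq_colourLim U g).and h).exists
  exact h1.symm.trans h2

/-- Overwrite the sequence `p` by the constant `a` from position `x` onwards. -/
def overwrite {A : Type*} (p : ℕ → A) (x : ℕ) (a : A) : ℕ → A :=
  fun i => if i < x then p i else a

/-- The colour of words whose successive blocks carry the letters of a list, as an iterated limit
along `U`: the outermost limit moves the first block boundary, the next one the second boundary, and
so on, and the innermost limit is over the length `n`. The word starts with the first `x` letters of
`p`, and an additional last block carries the letter `0`. -/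
noncomputable def limitColourFrom {r : ℕ} (U : Ultrafilter ℕ)
    (C : ∀ n, (Fin n → Fin 3) → Fin r) : List (Fin 3) → (ℕ → Fin 3) → ℕ → Fin r
  | [], p, x => colourLim U fun n => C n fun i => overwrite p x 0 i
  | a :: w, p, x => colourLim U fun y => limitColourFrom U C w (overwrite p x a) y

/-- The limit colour of a list of letters, each of which stands for a block of equal letters. -/
noncomputable def limitColour {r : ℕ} (U : Ultrafilter ℕ)
    (C : ∀ n, (Fin n → Fin 3) → Fin r) (w : List (Fin 3)) : Fin r :=
  limitColourFrom U C w 0 0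

lemma limitColourFrom_congr {r : ℕ} (U : Ultrafilter ℕ) (C : ∀ n, (Fin n → Fin 3) → Fin r)
    (u : List (Fin 3)) {v w : List (Fin 3)}
    (h : ∀ p x, limitColourFrom U C v p x = limitColourFrom U C w p x) (p : ℕ → Fin 3) (x : ℕ) :
    limitColourFrom U C (u ++ v) p x = limitColourFrom U C (u ++ w) p x := by
  induction u generalizing p x with
  | nil => exact h p x
  | cons a u ih => simp only [List.cons_append, limitColourFrom, ih]

/-- Two consecutive blocks with the same letter can be merged: the boundary between them does not
affect the word. -/
lemma limitColourFrom_merge {r : ℕ} {U : Ultrafilter ℕ} (hU : (U : Filter ℕ) ≤ atTop)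
    (C : ∀ n, (Fin n → Fin 3) → Fin r) (a : Fin 3) (w : List (Fin 3)) (p : ℕ → Fin 3) (x : ℕ) :
    limitColourFrom U C (a :: a :: w) p x = limitColourFrom U C (a :: w) p x := by
  rw [limitColourFrom]
  refine colourLim_eq ?_
  filter_upwards [hU (eventually_ge_atTop x)] with y hy
  have hov : overwrite (overwrite p x a) y a = overwrite p x a := by
    funext i
    simp only [overwrite]
    split_ifs <;> first | rfl | omega
  rw [limitColourFrom, limitColourFrom, hov]

theorem limitColour_merge {r : ℕ} {U : Ultrafilter ℕ} (hU : (U : Filter ℕ) ≤ atTop)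
    (C : ∀ n, (Fin n → Fin 3) → Fin r) (a : Fin 3) (u v : List (Fin 3)) :
    limitColour U C (u ++ [a, a] ++ v) = limitColour U C (u ++ [a] ++ v) := by
  simp only [limitColour, List.append_assoc]
  exact limitColourFrom_congr U C u (fun p x => limitColourFrom_merge hU C a v p x) 0 0

/-- Substitute the letter `a` for the stars (`none`) of a pattern. -/
def fill (a : Fin 3) (l : List (Option (Fin 3))) : List (Fin 3) :=
  l.map fun o => o.getD a

lemma exists_iUnion_Icc_union {n q : ℕ} (s : Set (Fin n)) (c d : Fin n)
    (hs : ∃ a b : Fin q → Fin n, s = ⋃ j, Set.Icc (a j) (b j)) :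
    ∃ a b : Fin (q + 1) → Fin n, Set.Icc c d ∪ s = ⋃ j, Set.Icc (a j) (b j) := by
  obtain ⟨a, b, rfl⟩ := hs
  refine ⟨Fin.cons c a, Fin.cons d b, ?_⟩
  ext i
  simp [Fin.exists_fin_succ]

/-- A pattern that is monochromatic for the limit colour yields, for most `n`, a template of
length `n` that is monochromatic for `C n`, and whose stars beyond position `x` form one interval
for each star of the pattern. -/
lemma eventually_exists_template {r : ℕ} {U : Ultrafilter ℕ} (hU : (U : Filter ℕ) ≤ atTop)
    (C : ∀ n, (Fin n → Fin 3) → Fin r) (c : Fin r) (l : List (Option (Fin 3)))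
    (P : ℕ → Option (Fin 3)) (x : ℕ)
    (h : ∀ a, limitColourFrom U C (fill a l) (fun i => (P i).getD a) x = c) :
    ∀ᶠ n in U, ∃ Q : ℕ → Option (Fin 3), (∀ i < x, Q i = P i) ∧
      (∀ a, C n (fun i => (Q i).getD a) = c) ∧
      (∃ a b : Fin (l.count none) → Fin n,
        {i : Fin n | x ≤ i ∧ Q i = none} = ⋃ j, Set.Icc (a j) (b j)) ∧
      (none ∈ l → ∃ i : Fin n, Q i = none) := by
  induction l generalizing P x with
  | nil =>
    have h' : ∀ a, ∀ᶠ n in U, C n (fun i => (overwrite P x (some 0) i).getD a) = c := by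
      intro a
      rw [← h a]
      filter_upwards [eventually_eq_colourLim U
        fun n => C n fun i => overwrite (fun i => (P i).getD a) x 0 i] with n hn
      refine Eq.trans ?_ hn
      congr 1
      funext i
      simp only [overwrite]
      split_ifs <;> rfl
    filter_upwards [eventually_all.2 h'] with n hn
    refine ⟨overwrite P x (some 0), fun i hi => if_pos hi, hn, ⟨Fin.elim0, Fin.elim0, ?_⟩, by simp⟩
    ext i
    simp only [Set.mem_ofPred_eq, List.count_nil, Set.iUnion_of_empty, Set.mem_empty_iff_false,
      iff_false, not_and]
    intro hi
    simp [overwrite, not_lt.2 hi]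
  | cons o l ih =>
    have h' : ∀ a, ∀ᶠ y in U,
        limitColourFrom U C (fill a l) (fun i => (overwrite P x o i).getD a) y = c := by
      intro a
      rw [← h a]
      filter_upwards [eventually_eq_colourLim U fun y => limitColourFrom U C (fill a l)
        (overwrite (fun i => (P i).getD a) x (o.getD a)) y] with y hy
      refine Eq.trans ?_ hy
      congr 1
      funext i
      simp only [overwrite]
      split_ifs <;> rfl
    obtain ⟨y, hy, hxy⟩ := ((eventually_all.2 h').and (hU (eventually_gt_atTop x))).exists
    filter_upwards [ih _ _ hy, hU (eventually_gt_atTop y)] with n hn hyn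
    obtain ⟨Q, hQ, hC, hI, hne⟩ := hn
    have hQP : ∀ i < x, Q i = P i := fun i hi => by
      rw [hQ i (hi.trans hxy)]
      exact if_pos hi
    have hQo : ∀ i, x ≤ i → i < y → Q i = o := fun i hi hi' => by
      rw [hQ i hi']
      exact if_neg (by omega)
    refine ⟨Q, hQP, hC, ?_, ?_⟩
    · rcases o with _ | a
      · rw [List.count_cons_self]
        have hset : {i : Fin n | x ≤ i ∧ Q i = none} =
            Set.Icc ⟨x, hxy.trans hyn⟩ ⟨y - 1, by omega⟩ ∪ {i : Fin n | y ≤ i ∧ Q i = none} := by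
          ext i
          simp only [Set.mem_ofPred_eq, Set.mem_union, Set.mem_Icc, Fin.le_def]
          by_cases hiy : (i : ℕ) < y
          · constructor
            · exact fun hi => Or.inl ⟨hi.1, by omega⟩
            · rintro (hi | hi)
              · exact ⟨hi.1, hQo i hi.1 hiy⟩
              · omega
          · constructor
            · exact fun hi => Or.inr ⟨by omega, hi.2⟩
            · rintro (hi | hi)
              · omega
              · exact ⟨by omega, hi.2⟩
        rw [hset]
        exact exists_iUnion_Icc_union _ _ _ hI
      · rw [List.count_cons_of_ne (by simp)]
        have hset : {i : Fin n | x ≤ i ∧ Q i = none} = {i : Fin n | y ≤ i ∧ Q i = none} := by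
          ext i
          simp only [Set.mem_ofPred_eq]
          by_cases hiy : (i : ℕ) < y
          · constructor
            · rintro ⟨hi, hi'⟩
              rw [hQo i hi hiy] at hi'
              cases hi'
            · intro hi
              omega
          · constructor
            · exact fun hi => ⟨by omega, hi.2⟩
            · exact fun hi => ⟨by omega, hi.2⟩
        rw [hset]
        exact hI
    · intro ho
      rcases List.mem_cons.1 ho with rfl | ho
      · exact ⟨⟨x, hxy.trans hyn⟩, hQo x le_rfl hxy⟩
      · exact hne ho

/-- If the colourings `C n` have no monochromatic line with few intervals, for most `n`, then no
pattern with few stars is monochromatic for the limit colour. -/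
theorem limitColour_not_mono {r q : ℕ} {U : Ultrafilter ℕ} (hU : (U : Filter ℕ) ≤ atTop)
    (C : ∀ n, (Fin n → Fin 3) → Fin r)
    (hC : ∀ᶠ n in U, ∀ l : Combinatorics.Line (Fin 3) (Fin n), l.IsMono (C n) → ¬ IsFold q l)
    (l : List (Option (Fin 3))) (hl0 : 0 < l.count none) (hlq : l.count none ≤ q) (c : Fin r) :
    ∃ a, limitColour U C (fill a l) ≠ c := by
  by_contra! h
  have hstart : ∀ a, limitColourFrom U C (fill a l)
      (fun i => ((fun _ => some 0 : ℕ → Option (Fin 3)) i).getD a) 0 = c := h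
  obtain ⟨n, ⟨Q, -, hQ, ⟨a, b, hab⟩, hne⟩, hn⟩ :=
    ((eventually_exists_template hU C c l _ 0 hstart).and hC).exists
  let L : Combinatorics.Line (Fin 3) (Fin n) :=
    ⟨fun i => Q i, hne (List.count_pos_iff.1 hl0)⟩
  refine hn L ⟨c, fun t => ?_⟩ ?_
  · rw [← hQ t]
    congr 1
  · have hset : activeSet L = ⋃ j, Set.Icc (a j) (b j) := by
      rw [← hab]
      ext i
      simp [activeSet, L]
    -- Repeating one interval brings the number of intervals up to `q`.
    let e : Fin q → Fin (l.count none) := fun j => if h : (j : ℕ) < l.count none then ⟨j, h⟩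
      else ⟨0, hl0⟩
    have he : Function.Surjective e := fun j =>
      ⟨⟨j, j.2.trans_le hlq⟩, by simp [e]⟩
    refine ⟨a ∘ e, b ∘ e, ?_⟩
    rw [hset]
    exact (he.iUnion_comp fun j => Set.Icc (a j) (b j)).symm

end

/-! ### Insertion of letters into words -/

lemma letter_cases (i : Fin 3) : i = 0 ∨ i = 1 ∨ i = 2 := by revert i; decide

lemma letters_ne (i : Fin 3) : i ≠ i + 1 ∧ i ≠ i + 2 ∧ i + 1 ≠ i + 2 := by revert i; decide

/-- The `n`-fold repetition of a word. -/
def wordPow {A : Type*} (n : ℕ) (w : List A) : List A := (List.replicate n w).flatten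

lemma wordPow_zero {A : Type*} (w : List A) : wordPow 0 w = [] := rfl

lemma wordPow_add {A : Type*} (m n : ℕ) (w : List A) :
    wordPow (m + n) w = wordPow m w ++ wordPow n w := by
  rw [wordPow, List.replicate_add, List.flatten_append, wordPow, wordPow]

lemma wordPow_one {A : Type*} (w : List A) : wordPow 1 w = w := by simp [wordPow]

lemma wordPow_succ {A : Type*} (n : ℕ) (w : List A) :
    wordPow (n + 1) w = wordPow n w ++ w := by
  rw [wordPow_add, wordPow_one]

/-- A colouring of words which does not see repetitions of a letter, and for which no pattern with
at least one and fewer than `r` stars is monochromatic. -/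
structure IsReducedColouring {r : ℕ} (c : List (Fin 3) → Fin r) : Prop where
  merge : ∀ a u v, c (u ++ [a, a] ++ v) = c (u ++ [a] ++ v)
  not_mono : ∀ l : List (Option (Fin 3)), 0 < l.count none → l.count none < r →
    ∀ k, ∃ a, c (fill a l) ≠ k

section

variable {r : ℕ} {c : List (Fin 3) → Fin r}

/-- Two words are interchangeable for a colouring if they give the same colour in all contexts. -/
def Interchangeable (c : List (Fin 3) → Fin r) (u v : List (Fin 3)) : Prop :=
  ∀ s t, c (s ++ u ++ t) = c (s ++ v ++ t)

lemma Interchangeable.append {u v u' v' : List (Fin 3)} (h : Interchangeable c u v)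
    (h' : Interchangeable c u' v') : Interchangeable c (u ++ u') (v ++ v') := by
  intro s t
  have h1 := h s (u' ++ t)
  have h2 := h' (s ++ v) t
  simp only [List.append_assoc] at h1 h2 ⊢
  exact h1.trans h2

/-- The family `U` of words arises, up to interchangeability, by substituting the three letters for
the stars of a pattern with `k` stars. -/
def IsSubstitution (c : List (Fin 3) → Fin r) (k : ℕ) (U : Fin 3 → List (Fin 3)) : Prop :=
  ∃ l : List (Option (Fin 3)), l.count none = k ∧ ∀ a, Interchangeable c (fill a l) (U a)

lemma IsSubstitution.append {k k' : ℕ} {U U' : Fin 3 → List (Fin 3)} (h : IsSubstitution c k U)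
    (h' : IsSubstitution c k' U') : IsSubstitution c (k + k') fun a => U a ++ U' a := by
  obtain ⟨l, hl, hU⟩ := h
  obtain ⟨l', hl', hU'⟩ := h'
  refine ⟨l ++ l', by rw [List.count_append, hl, hl'], fun a => ?_⟩
  rw [fill, List.map_append]
  exact (hU a).append (hU' a)

lemma isSubstitution_const (c : List (Fin 3) → Fin r) (u : List (Fin 3)) :
    IsSubstitution c 0 fun _ => u := by
  refine ⟨u.map some, ?_, fun a s t => ?_⟩
  · rw [List.count_eq_zero]; simp
  · simp [fill, Function.comp_def]

lemma IsSubstitution.pow {k : ℕ} {U : Fin 3 → List (Fin 3)} (h : IsSubstitution c k U) (n : ℕ) :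
    IsSubstitution c (n * k) fun a => wordPow n (U a) := by
  induction n with
  | zero => simpa [wordPow_zero] using isSubstitution_const c []
  | succ n ih => simpa only [wordPow_succ, Nat.succ_mul] using ih.append h

lemma IsSubstitution.not_mono (hc : IsReducedColouring c) {k : ℕ} {U : Fin 3 → List (Fin 3)}
    (h : IsSubstitution c k U) (hk0 : 0 < k) (hkr : k < r) (d : Fin r) : ∃ a, c (U a) ≠ d := by
  obtain ⟨l, rfl, hU⟩ := h
  obtain ⟨a, ha⟩ := hc.not_mono l hk0 hkr d
  refine ⟨a, ?_⟩
  have := hU a [] []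
  simp only [List.nil_append, List.append_nil] at this
  rwa [← this]

/-- A star between two distinct letters only matters when it is replaced by the third letter. -/
lemma isSubstitution_slot (hc : IsReducedColouring c) {i a b : Fin 3} (hia : i ≠ a) (hib : i ≠ b)
    (hab : a ≠ b) : IsSubstitution c 1 fun t => if t = i then [a, i, b] else [a, b] := by
  refine ⟨[some a, none, some b], by simp, fun t s s' => ?_⟩
  rcases eq_or_ne t i with rfl | hti
  · simp [fill]
  · have : t = a ∨ t = b := by
      revert i a b t; decide
    simp only [if_neg hti]
    rcases this with rfl | rfl
    · simpa [fill] using hc.merge t s (b :: s')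
    · simpa [fill] using hc.merge t (s ++ [a]) s'

lemma isSubstitution_loop (hc : IsReducedColouring c) (i : Fin 3) :
    IsSubstitution c 1 fun t => if t = i then [i] else [i, t, i] := by
  refine ⟨[some i, none, some i], by simp, fun t s s' => ?_⟩
  rcases eq_or_ne t i with rfl | hti
  · have h1 := hc.merge t s (t :: s')
    have h2 := hc.merge t s s'
    simp only [List.append_assoc, List.cons_append, List.nil_append] at h1 h2
    simpa [fill] using h1.trans h2
  · simp [fill, hti]

/-- The word `v` arises from `u` by inserting the letter `i` at `k` places between the two other
letters. -/
def IsInsertion (c : List (Fin 3) → Fin r) (i : Fin 3) (k : ℕ) (u v : List (Fin 3)) : Prop :=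
  IsSubstitution c k fun t => if t = i then v else u

lemma IsInsertion.append {i : Fin 3} {k k' : ℕ} {u v u' v' : List (Fin 3)}
    (h : IsInsertion c i k u v) (h' : IsInsertion c i k' u' v') :
    IsInsertion c i (k + k') (u ++ u') (v ++ v') := by
  have := IsSubstitution.append h h'
  unfold IsInsertion
  convert this using 2 with t
  split_ifs <;> rfl

lemma IsInsertion.pow {i : Fin 3} {k : ℕ} {u v : List (Fin 3)} (h : IsInsertion c i k u v) (n : ℕ) :
    IsInsertion c i (n * k) (wordPow n u) (wordPow n v) := by
  have := IsSubstitution.pow h n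
  unfold IsInsertion
  convert this using 2 with t
  split_ifs <;> rfl

lemma isInsertion_refl (c : List (Fin 3) → Fin r) (i : Fin 3) (u : List (Fin 3)) :
    IsInsertion c i 0 u u := by
  simpa [IsInsertion] using isSubstitution_const c u

lemma IsInsertion.ne (hc : IsReducedColouring c) {i : Fin 3} {k : ℕ} {u v : List (Fin 3)}
    (h : IsInsertion c i k u v) (hk0 : 0 < k) (hkr : k < r) : c u ≠ c v := by
  intro huv
  obtain ⟨a, ha⟩ := IsSubstitution.not_mono hc h hk0 hkr (c u)
  apply ha
  split_ifs
  · exact huv.symm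
  · rfl

/-- A word with `2 * r` places between the letters other than `i`, at `d` of which the letter `i`
is inserted. -/
def reserve (r : ℕ) (i : Fin 3) (d : ℕ) : List (Fin 3) :=
  wordPow d [i + 1, i, i + 2] ++ wordPow (2 * r - d) [i + 1, i + 2]

lemma isInsertion_reserve (hc : IsReducedColouring c) (i : Fin 3) {d k : ℕ} (h : d + k ≤ 2 * r) :
    IsInsertion c i k (reserve r i d) (reserve r i (d + k)) := by
  have h1 : IsInsertion c i 1 [i + 1, i + 2] [i + 1, i, i + 2] :=
    isSubstitution_slot hc (letters_ne i).1 (letters_ne i).2.1 (letters_ne i).2.2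
  have h2 := ((isInsertion_refl c i (wordPow d [i + 1, i, i + 2])).append (h1.pow k)).append
    (isInsertion_refl c i (wordPow (2 * r - (d + k)) [i + 1, i + 2]))
  have e : 2 * r - d = k + (2 * r - (d + k)) := by omega
  rw [reserve, reserve, e, wordPow_add d k, wordPow_add k]
  simpa using h2

/-- Two colours avoided by `r - 1` distinct colours agree. -/
lemma eq_of_avoid {T : ℕ → Fin r} (hT : ∀ j k, j < k → k < r - 1 → T j ≠ T k) {e e' : Fin r}
    (he : ∀ j < r - 1, T j ≠ e) (he' : ∀ j < r - 1, T j ≠ e') : e = e' := by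
  classical
  have hinj : Set.InjOn T (Finset.range (r - 1)) := by
    intro j hj k hk hjk
    have hj' := Finset.mem_range.1 (Finset.mem_coe.1 hj)
    have hk' := Finset.mem_range.1 (Finset.mem_coe.1 hk)
    rcases lt_trichotomy j k with h | h | h
    · exact absurd hjk (hT j k h hk')
    · exact h
    · exact absurd hjk.symm (hT k j h hj')
  have hcard : (((Finset.range (r - 1)).image T)ᶜ).card ≤ 1 := by
    rw [Finset.card_compl, Finset.card_image_of_injOn hinj]
    simp only [Fintype.card_fin, Finset.card_range]
    omega
  refine Finset.card_le_one.1 hcard e ?_ e' ?_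
  · simpa using he
  · simpa using he'

/-- The letter `i` may be moved from any place between the two other letters into the reserve. -/
lemma colour_move (hc : IsReducedColouring c) {i a b : Fin 3} (hia : i ≠ a) (hib : i ≠ b)
    (hab : a ≠ b) (s s' t : List (Fin 3)) {d : ℕ} (hd : d < r) :
    c (s ++ [a, i, b] ++ s' ++ reserve r i d ++ t) =
      c (s ++ [a, b] ++ s' ++ reserve r i (d + 1) ++ t) := by
  have hslot : IsInsertion c i 1 (s ++ [a, b] ++ s') (s ++ [a, i, b] ++ s') := by
    have := ((isInsertion_refl c i s).append (isSubstitution_slot hc hia hib hab :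
      IsInsertion c i 1 [a, b] [a, i, b])).append (isInsertion_refl c i s')
    simpa using this
  have hres : ∀ {d k : ℕ}, d + k ≤ 2 * r → ∀ {m : ℕ} {u v : List (Fin 3)}, IsInsertion c i m u v →
      0 < m + k → m + k < r → c (u ++ reserve r i d ++ t) ≠ c (v ++ reserve r i (d + k) ++ t) := by
    intro d k h m u v huv h0 hr
    have := (huv.append (isInsertion_reserve hc i h)).append (isInsertion_refl c i t)
    exact this.ne hc h0 hr
  refine eq_of_avoid (T := fun j => c (s ++ [a, i, b] ++ s' ++ reserve r i (d + 1 + j) ++ t))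
    (fun j k hjk hk => ?_) (fun j hj => ?_) (fun j hj => ?_)
  · have := hres (d := d + 1 + j) (k := k - j) (by omega)
      (isInsertion_refl c i (s ++ [a, i, b] ++ s')) (by omega) (by omega)
    rwa [show d + 1 + j + (k - j) = d + 1 + k by omega] at this
  · have := hres (d := d) (k := 1 + j) (by omega)
      (isInsertion_refl c i (s ++ [a, i, b] ++ s')) (by omega) (by omega)
    rw [← add_assoc] at this
    exact this.symm
  · exact (hres (d := d + 1) (k := j) (by omega) hslot (by omega) (by omega)).symm

lemma colour_reserve_period (hc : IsReducedColouring c) (i : Fin 3) (s t : List (Fin 3)) :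
    c (s ++ reserve r i r ++ t) = c (s ++ reserve r i 0 ++ t) := by
  have hres : ∀ {d k : ℕ}, d + k ≤ 2 * r → 0 < k → k < r →
      c (s ++ reserve r i d ++ t) ≠ c (s ++ reserve r i (d + k) ++ t) := by
    intro d k h h0 hr
    have := ((isInsertion_refl c i s).append (isInsertion_reserve hc i h)).append
      (isInsertion_refl c i t)
    exact this.ne hc (by omega) (by omega)
  refine eq_of_avoid (T := fun j => c (s ++ reserve r i (1 + j) ++ t))
    (fun j k hjk hk => ?_) (fun j hj => ?_) (fun j hj => ?_)
  · have := hres (d := 1 + j) (k := k - j) (by omega) (by omega) (by omega)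
    rwa [show 1 + j + (k - j) = 1 + k by omega] at this
  · have := hres (d := 1 + j) (k := r - (1 + j)) (by omega) (by omega) (by omega)
    rwa [show 1 + j + (r - (1 + j)) = r by omega] at this
  · have := hres (d := 0) (k := 1 + j) (by omega) (by omega) (by omega)
    rw [zero_add] at this
    exact this.symm

lemma colour_move_zmod [NeZero r] (hc : IsReducedColouring c) {i a b : Fin 3} (hia : i ≠ a)
    (hib : i ≠ b) (hab : a ≠ b) (s s' t : List (Fin 3)) (d : ZMod r) :
    c (s ++ [a, i, b] ++ s' ++ reserve r i d.val ++ t) =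
      c (s ++ [a, b] ++ s' ++ reserve r i (d + 1).val ++ t) := by
  have hd := ZMod.val_lt d
  have hval : (d + 1).val = (d.val + 1) % r := by
    rw [← ZMod.val_natCast]; simp
  rw [colour_move hc hia hib hab s s' t hd, hval]
  rcases lt_or_eq_of_le (Nat.succ_le_of_lt hd) with h | h
  · rw [Nat.mod_eq_of_lt h]
  · rw [show d.val + 1 = r from h, Nat.mod_self]
    exact colour_reserve_period hc i _ t

/-- The colour of a word followed by reserves of all three letters in prescribed states. -/
def stateColour (c : List (Fin 3) → Fin r) (u : List (Fin 3)) (p : Fin 3 → ZMod r) : Fin r :=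
  c (u ++ (reserve r 0 (p 0).val ++ reserve r 1 (p 1).val ++ reserve r 2 (p 2).val))

/-- Replacing `u` by `u'` in any context has the same effect on colours as the translation of the
state of the reserves by `v`. -/
def IsShift (c : List (Fin 3) → Fin r) (u u' : List (Fin 3)) (v : Fin 3 → ZMod r) : Prop :=
  ∀ s t p, stateColour c (s ++ u' ++ t) p = stateColour c (s ++ u ++ t) (p + v)

lemma isShift_refl (c : List (Fin 3) → Fin r) (u : List (Fin 3)) : IsShift c u u 0 := by
  intro s t p
  rw [add_zero]

lemma IsShift.trans {u₁ u₂ u₃ : List (Fin 3)} {v w : Fin 3 → ZMod r} (h : IsShift c u₁ u₂ v)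
    (h' : IsShift c u₂ u₃ w) : IsShift c u₁ u₃ (w + v) := by
  intro s t p
  rw [h', h, add_assoc]

lemma IsShift.append {u u' w w' : List (Fin 3)} {v x : Fin 3 → ZMod r} (h : IsShift c u u' v)
    (h' : IsShift c w w' x) : IsShift c (u ++ w) (u' ++ w') (v + x) := by
  intro s t p
  have h1 := h s (w' ++ t) p
  have h2 := h' (s ++ u) t (p + v)
  simp only [List.append_assoc, add_assoc] at h1 h2 ⊢
  exact h1.trans h2

lemma isShift_slot [NeZero r] (hc : IsReducedColouring c) {i a b : Fin 3} (hia : i ≠ a)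
    (hib : i ≠ b) (hab : a ≠ b) : IsShift c [a, b] [a, i, b] (Pi.single i 1) := by
  intro s t p
  have hi := letter_cases i
  rcases hi with rfl | rfl | rfl
  · have := colour_move_zmod hc hia hib hab s t
      (reserve r 1 (p 1).val ++ reserve r 2 (p 2).val) (p 0)
    simpa [stateColour] using this
  · have := colour_move_zmod hc hia hib hab s (t ++ reserve r 0 (p 0).val)
      (reserve r 2 (p 2).val) (p 1)
    simpa [stateColour] using this
  · have := colour_move_zmod hc hia hib hab s (t ++ reserve r 0 (p 0).val ++ reserve r 1 (p 1).val)
      [] (p 2)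
    simpa [stateColour] using this

/-- Doubling the letter `i` around a letter `t` has the effect of inserting one `i` and one `t`. -/
lemma isShift_loop [NeZero r] (hc : IsReducedColouring c) {i t : Fin 3} (hti : t ≠ i) :
    IsShift c [i + 2, i, i + 1] [i + 2, i, t, i, i + 1] (Pi.single i 1 + Pi.single t 1) := by
  obtain ⟨d1, d2, d3⟩ := letters_ne i
  have ht : t = i + 1 ∨ t = i + 2 := by revert i t; decide
  rcases ht with rfl | rfl
  · have h1 := (isShift_slot hc (i := i + 1) (a := i + 2) (b := i) d3 hti d2.symm).append
      (isShift_refl c [i + 1])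
    have h2 := (isShift_slot hc (i := i) (a := i + 2) (b := i + 1) d2 d1 d3.symm).append
      (isShift_refl c [i, i + 1])
    simpa using h1.trans h2
  · have h1 := (isShift_refl c [i + 2]).append
      (isShift_slot hc (i := i + 2) (a := i) (b := i + 1) hti d3.symm d1)
    have h2 := (isShift_refl c [i + 2, i]).append
      (isShift_slot hc (i := i) (a := i + 2) (b := i + 1) d2 d1 d3.symm)
    simpa using h1.trans h2

/-- A word containing every arrangement needed: the pairs `01`, `12`, `20` and the triples `012`,
`120`, `201`. -/
def basicWord : List (Fin 3) := [0, 1, 2, 0, 1]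

/-- Some pattern with `k` stars, obtained from `m` copies of the basic word, is substituted by the
letter `a` with the effect of a translation by `V a`. -/
def IsConfiguration (c : List (Fin 3) → Fin r) (m k : ℕ) (V : Fin 3 → Fin 3 → ZMod r) : Prop :=
  ∃ U, IsSubstitution c k U ∧ ∀ a, IsShift c (wordPow m basicWord) (U a) (V a)

lemma IsConfiguration.append {m k m' k' : ℕ} {V V' : Fin 3 → Fin 3 → ZMod r}
    (h : IsConfiguration c m k V) (h' : IsConfiguration c m' k' V') :
    IsConfiguration c (m + m') (k + k') (V + V') := by
  obtain ⟨U, hU, hV⟩ := h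
  obtain ⟨U', hU', hV'⟩ := h'
  refine ⟨_, hU.append hU', fun a => ?_⟩
  rw [wordPow_add]
  exact (hV a).append (hV' a)

lemma isConfiguration_zero (c : List (Fin 3) → Fin r) (m : ℕ) : IsConfiguration c m 0 0 :=
  ⟨_, isSubstitution_const c _, fun _ => isShift_refl c _⟩

lemma IsConfiguration.pow {V : Fin 3 → Fin 3 → ZMod r} (h : IsConfiguration c 1 1 V) (n : ℕ) :
    IsConfiguration c n n (n • V) := by
  induction n with
  | zero => simpa using isConfiguration_zero c 0
  | succ n ih => simpa only [succ_nsmul] using ih.append h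

lemma isConfiguration_of_infix {s u t : List (Fin 3)} (hb : basicWord = s ++ u ++ t)
    {U : Fin 3 → List (Fin 3)} {V : Fin 3 → Fin 3 → ZMod r} (hU : IsSubstitution c 1 U)
    (hV : ∀ a, IsShift c u (U a) (V a)) : IsConfiguration c 1 1 V := by
  refine ⟨fun a => s ++ U a ++ t, ?_, fun a => ?_⟩
  · simpa using ((isSubstitution_const c s).append hU).append (isSubstitution_const c t)
  · rw [wordPow_one, hb]
    simpa using ((isShift_refl c s).append (hV a)).append (isShift_refl c t)

lemma isConfiguration_slot [NeZero r] (hc : IsReducedColouring c) (i : Fin 3) :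
    IsConfiguration c 1 1 fun a => if a = i then Pi.single i 1 else 0 := by
  obtain ⟨d1, d2, d3⟩ := letters_ne i
  obtain ⟨s, t, hb⟩ : ∃ s t, basicWord = s ++ [i + 1, i + 2] ++ t := by
    have hi := letter_cases i
    rcases hi with rfl | rfl | rfl
    · exact ⟨[0], [0, 1], rfl⟩
    · exact ⟨[0, 1], [1], rfl⟩
    · exact ⟨[], [2, 0, 1], rfl⟩
  refine isConfiguration_of_infix hb (isSubstitution_slot hc d1 d2 d3) fun a => ?_
  split_ifs
  · exact isShift_slot hc d1 d2 d3
  · exact isShift_refl c _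

lemma isConfiguration_loop [NeZero r] (hc : IsReducedColouring c) (i : Fin 3) :
    IsConfiguration c 1 1 fun a => if a = i then 0 else Pi.single i 1 + Pi.single a 1 := by
  obtain ⟨s, t, hb⟩ : ∃ s t, basicWord = s ++ [i + 2, i, i + 1] ++ t := by
    have hi := letter_cases i
    rcases hi with rfl | rfl | rfl
    · exact ⟨[0, 1], [], rfl⟩
    · exact ⟨[], [0, 1], rfl⟩
    · exact ⟨[0], [1], rfl⟩
  have hU := ((isSubstitution_const c [i + 2]).append (isSubstitution_loop hc i)).append
    (isSubstitution_const c [i + 1])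
  refine isConfiguration_of_infix hb (by simpa using hU) fun a => ?_
  split_ifs with ha
  · exact isShift_refl c _
  · exact isShift_loop hc ha

lemma isConfiguration_sum [NeZero r] (hc : IsReducedColouring c) (x k : Fin 3 → ℕ) :
    IsConfiguration c (∑ i, (x i + k i)) (∑ i, (x i + k i)) (∑ i,
      (x i • (fun a => if a = i then Pi.single i 1 else 0) +
        k i • (fun a => if a = i then 0 else Pi.single i 1 + Pi.single a 1))) := by
  have h : ∀ i, IsConfiguration c (x i + k i) (x i + k i)
      (x i • (fun a => if a = i then Pi.single i 1 else 0) +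
        k i • (fun a => if a = i then 0 else Pi.single i 1 + Pi.single a 1)) := fun i =>
    ((isConfiguration_slot hc i).pow _).append ((isConfiguration_loop hc i).pow _)
  simp only [Fin.sum_univ_three]
  exact ((h 0).append (h 1)).append (h 2)

end

/-! ### Colourings of the group `(ZMod r) ^ 3` -/

section

open Finset

/-- The induction step of `sum_eq_or_eq` for one coordinate: if the total distance is known to be
`r` or `2 * r` wherever `Y` or `Z` is nearer than `k` to `0` or `r`, the same holds on the slices
`X = k` and `X = r - k`. -/
lemma slice_sum_eq_or_eq {Q : Type*} [Fintype Q] {r k : ℕ} (X Y Z : Q → ℕ) (φ ψ : Q → Q)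
    (hφ : Function.Involutive φ) (hψ : Function.Involutive ψ)
    (hXr : ∀ q, X q < r) (hY0 : ∀ q, 0 < Y q) (hYr : ∀ q, Y q < r)
    (hZ0 : ∀ q, 0 < Z q) (hZr : ∀ q, Z q < r)
    (hφX : ∀ q, X (φ q) = r - X q) (hφY : ∀ q, Y (φ q) = r - Y q)
    (hψX : ∀ q, X (ψ q) = r - X q) (hψZ : ∀ q, Z (ψ q) = r - Z q)
    (hS : ∀ q, r ≤ X q + Y q + Z q)
    (hT : ∀ q, r ≤ X q + Y q → r ≤ X q + Z q → 2 * r ≤ X q + Y q + Z q)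
    (hk0 : 0 < k) (hk : 2 * k ≤ r)
    (ihY : ∀ q, Y q < k ∨ r < Y q + k → X q + Y q + Z q = r ∨ X q + Y q + Z q = 2 * r)
    (ihZ : ∀ q, Z q < k ∨ r < Z q + k → X q + Y q + Z q = r ∨ X q + Y q + Z q = 2 * r)
    (q : Q) (hq : X q = k ∨ X q = r - k) :
    X q + Y q + Z q = r ∨ X q + Y q + Z q = 2 * r := by
  classical
  let lo : Finset Q := univ.filter fun q => X q = k
  let hi : Finset Q := univ.filter fun q => X q = r - k
  have mem_lo : ∀ q, q ∈ lo ↔ X q = k := fun q => by simp [lo]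
  have mem_hi : ∀ q, q ∈ hi ↔ X q = r - k := fun q => by simp [hi]
  let S : Q → ℕ := fun q => X q + Y q + Z q
  have himg : ∀ χ : Q → Q, Function.Involutive χ → (∀ q, X (χ q) = r - X q) →
      hi = lo.image χ := by
    intro χ hχ hχX
    ext q
    rw [mem_hi, mem_image]
    constructor
    · intro h
      exact ⟨χ q, (mem_lo _).2 (by rw [hχX]; have := hXr q; omega), hχ q⟩
    · rintro ⟨q', h, rfl⟩
      rw [hχX, (mem_lo _).1 h]
  -- In the high slice `S < 2 * r` forces a small coordinate, whence `S = r`.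
  have hhi : ∀ q ∈ hi, S q = r ∨ 2 * r ≤ S q := by
    intro q hq
    rw [mem_hi] at hq
    by_contra hne
    push Not at hne
    have h1 : Y q < k ∨ Z q < k := by
      by_contra h
      push Not at h
      have := hT q (by omega) (by omega)
      simp only [S] at hne
      omega
    rcases h1 with h1 | h1
    · rcases ihY q (Or.inl h1) with h | h <;> simp only [S] at hne <;> omega
    · rcases ihZ q (Or.inl h1) with h | h <;> simp only [S] at hne <;> omega
  -- `φ` sends points of the high slice with `S = r` to points of the low slice with `S = 2 * r`.
  have hcard : (hi.filter fun q => S q < 2 * r).card ≤ (lo.filter fun q => 2 * r ≤ S q).card := by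
    refine card_le_card_of_injOn φ ?_ (hφ.injective.injOn)
    intro q hq
    obtain ⟨hq, hq2⟩ := mem_filter.1 (mem_coe.1 hq)
    have hSr := (hhi q hq).resolve_right (by omega)
    rw [mem_hi] at hq
    simp only [S] at hSr
    have hy := hY0 q
    have hz := hZ0 q
    rw [mem_coe, mem_filter, mem_lo, hφX]
    refine ⟨by omega, ?_⟩
    have hX' := hφX q
    have hY' := hφY q
    have hZ' := hZ0 (φ q)
    rcases ihY (φ q) (Or.inr (by omega)) with h | h
    · omega
    · exact h.ge
  -- The involutions determine the total of `S` over the two slices.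
  have htotal : ∑ q ∈ lo, (S q : ℤ) + ∑ q ∈ hi, (S q : ℤ) = 3 * r * lo.card := by
    have hX : ∑ q ∈ hi, (X q : ℤ) = ∑ q ∈ lo, ((r : ℤ) - X q) := by
      rw [himg φ hφ hφX, sum_image hφ.injective.injOn]
      exact sum_congr rfl fun q _ => by rw [hφX]; have := hXr q; omega
    have hY : ∑ q ∈ hi, (Y q : ℤ) = ∑ q ∈ lo, ((r : ℤ) - Y q) := by
      rw [himg φ hφ hφX, sum_image hφ.injective.injOn]
      exact sum_congr rfl fun q _ => by rw [hφY]; have := hYr q; omega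
    have hZ : ∑ q ∈ hi, (Z q : ℤ) = ∑ q ∈ lo, ((r : ℤ) - Z q) := by
      rw [himg ψ hψ hψX, sum_image hψ.injective.injOn]
      exact sum_congr rfl fun q _ => by rw [hψZ]; have := hZr q; omega
    simp only [S, Nat.cast_add, sum_add_distrib]
    rw [hX, hY, hZ]
    simp only [sum_sub_distrib, sum_const, nsmul_eq_mul]
    ring
  -- The excess of `S` over its lower bound is nonnegative, and its total is not positive.
  let D : Q → ℤ := fun q => S q - (if 2 * r ≤ S q then 2 * r else r : ℤ)
  have hD0 : ∀ q, 0 ≤ D q := by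
    intro q
    have := hS q
    simp only [D, S]
    split_ifs <;> omega
  have hcardhi : hi.card = lo.card := by
    rw [himg φ hφ hφX, card_image_of_injective _ hφ.injective]
  have hDsum : ∑ q ∈ lo, D q + ∑ q ∈ hi, D q ≤ 0 := by
    have e1 : ∀ s : Finset Q, ∑ q ∈ s, (if 2 * r ≤ S q then (2 * r : ℤ) else r)
        = r * s.card + r * (s.filter fun q => 2 * r ≤ S q).card := by
      intro s
      rw [← Finset.sum_filter_add_sum_filter_not s (fun q => 2 * r ≤ S q),
        ← Finset.card_filter_add_card_filter_not (s := s) (fun q => 2 * r ≤ S q),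
        sum_congr rfl (g := fun _ => (2 * r : ℤ)) (fun q hq => if_pos (mem_filter.1 hq).2),
        sum_congr rfl (g := fun _ => (r : ℤ)) (fun q hq => if_neg (mem_filter.1 hq).2)]
      simp only [sum_const, nsmul_eq_mul]
      push_cast
      ring
    have e2 : (hi.filter fun q => 2 * r ≤ S q).card + (hi.filter fun q => S q < 2 * r).card
        = lo.card := by
      rw [← hcardhi, ← Finset.card_filter_add_card_filter_not (s := hi) (fun q => 2 * r ≤ S q)]
      simp only [not_le]
    simp only [D, sum_sub_distrib]
    rw [e1, e1, hcardhi]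
    have e3 : (r : ℤ) * lo.card ≤ r * ((hi.filter fun q => 2 * r ≤ S q).card
        + (lo.filter fun q => 2 * r ≤ S q).card) := by
      refine mul_le_mul_of_nonneg_left ?_ (by positivity)
      exact_mod_cast (by omega)
    linarith
  have hz : D q = 0 := by
    have h1 : ∑ q ∈ lo, D q = 0 := by
      have := sum_nonneg fun q (_ : q ∈ lo) => hD0 q
      have := sum_nonneg fun q (_ : q ∈ hi) => hD0 q
      omega
    have h2 : ∑ q ∈ hi, D q = 0 := by
      have := sum_nonneg fun q (_ : q ∈ hi) => hD0 q
      have := sum_nonneg fun q (_ : q ∈ lo) => hD0 q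
      omega
    rcases hq with hq | hq
    · exact (sum_eq_zero_iff_of_nonneg fun q _ => hD0 q).1 h1 q ((mem_lo q).2 hq)
    · exact (sum_eq_zero_iff_of_nonneg fun q _ => hD0 q).1 h2 q ((mem_hi q).2 hq)
  simp only [D, S] at hz
  split_ifs at hz <;> omega

/-- Abstract counting statement behind the parity argument. The three functions `d i` are the
distances from a point outside a colour class to that class along the axes, and `φ i j` maps a point to
the opposite corner of the rectangle spanned by its two nearest points in the directions `i` and `j`,
which reverses both distances. The hypotheses `hS` and `hT` are lower bounds for the total distance;
since the involutions fix its average over the slices `d i = k` and `d i = r - k`, the bounds are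
attained. The proof is an induction on `k`, from the outermost slices towards the middle. -/
lemma sum_eq_or_eq {Q : Type*} [Fintype Q] {r : ℕ} (d : Fin 3 → Q → ℕ) (φ : Fin 3 → Fin 3 → Q → Q)
    (hd0 : ∀ i q, 0 < d i q) (hdr : ∀ i q, d i q < r)
    (hφ : ∀ i j, i ≠ j → Function.Involutive (φ i j))
    (hφl : ∀ i j q, i ≠ j → d i (φ i j q) = r - d i q)
    (hφr : ∀ i j q, i ≠ j → d j (φ i j q) = r - d j q)
    (hS : ∀ q, r ≤ d 0 q + d 1 q + d 2 q)
    (hT : ∀ i j k q, i ≠ j → i ≠ k → j ≠ k → r ≤ d i q + d j q → r ≤ d i q + d k q →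
      2 * r ≤ d i q + d j q + d k q)
    (q : Q) : d 0 q + d 1 q + d 2 q = r ∨ d 0 q + d 1 q + d 2 q = 2 * r := by
  have hsum : ∀ i j k q, i ≠ j → i ≠ k → j ≠ k →
      d i q + d j q + d k q = d 0 q + d 1 q + d 2 q := by
    intro i j k q hij hik hjk
    fin_cases i <;> fin_cases j <;> fin_cases k <;> first | (simp at hij hik hjk; done) | skip
    all_goals simp only [Fin.zero_eta, Fin.mk_one, Fin.reduceFinMk]
    all_goals omega
  have main : ∀ k, 0 < k → 2 * k ≤ r → ∀ i q, d i q = k ∨ d i q = r - k →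
      d 0 q + d 1 q + d 2 q = r ∨ d 0 q + d 1 q + d 2 q = 2 * r := by
    intro k
    induction k using Nat.strong_induction_on with
    | _ k ih =>
      intro hk0 hk i q hq
      have ih' : ∀ i q, d i q < k ∨ r < d i q + k →
          d 0 q + d 1 q + d 2 q = r ∨ d 0 q + d 1 q + d 2 q = 2 * r := by
        intro i q h
        have h0 := hd0 i q
        have hr := hdr i q
        rcases h with h | h
        · exact ih (d i q) h h0 (by omega) i q (Or.inl rfl)
        · exact ih (r - d i q) (by omega) (by omega) (by omega) i q (Or.inr (by omega))
      obtain ⟨j, l, hij, hil, hjl⟩ : ∃ j l : Fin 3, i ≠ j ∧ i ≠ l ∧ j ≠ l :=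
        (by decide : ∀ i : Fin 3, ∃ j l : Fin 3, i ≠ j ∧ i ≠ l ∧ j ≠ l) i
      have hs := fun q => hsum i j l q hij hil hjl
      rw [← hs]
      refine slice_sum_eq_or_eq (d i) (d j) (d l) (φ i j) (φ i l) (hφ i j hij) (hφ i l hil)
        (hdr i) (hd0 j) (hdr j) (hd0 l) (hdr l) (fun q => hφl i j q hij) (fun q => hφr i j q hij)
        (fun q => hφl i l q hil) (fun q => hφr i l q hil) (fun q => by rw [hs]; exact hS q)
        (fun q => hT i j l q hij hil hjl) hk0 hk (fun q h => ?_) (fun q h => ?_) q hq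
      · rw [hs]; exact ih' j q h
      · rw [hs]; exact ih' l q h
  have h0 := hd0 0 q
  have hr := hdr 0 q
  rcases le_total (2 * d 0 q) r with h | h
  · exact main (d 0 q) h0 h 0 q (Or.inl rfl)
  · exact main (r - d 0 q) (by omega) (by omega) 0 q (Or.inr (by omega))

/-- The sum is `r / 2`, by the Gauss summation formula. -/
lemma sum_zmod_ne_zero {r : ℕ} [NeZero r] (hr : Even r) : ∑ t : ZMod r, t ≠ 0 := by
  obtain ⟨m, hm⟩ := hr
  have hr0 := NeZero.pos r
  have h1 : ∑ t : ZMod r, t = ((∑ i ∈ range r, i : ℕ) : ZMod r) := by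
    push_cast
    refine sum_bij' (fun t _ => t.val) (fun i _ => (i : ZMod r)) ?_ ?_ ?_ ?_ ?_
    · intro t _; exact mem_range.2 (ZMod.val_lt t)
    · intros; exact mem_univ _
    · intro t _; exact ZMod.natCast_zmod_val t
    · intro i hi; exact ZMod.val_cast_of_lt (mem_range.1 hi)
    · intro t _; exact (ZMod.natCast_zmod_val t).symm
  rw [h1, Ne, ZMod.natCast_eq_zero_iff]
  have h2 := Finset.sum_range_id_mul_two r
  rintro ⟨c, hc⟩
  rw [hc, mul_assoc] at h2
  have h3 := Nat.eq_of_mul_eq_mul_left hr0 h2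
  omega

/-- For even `r`, every colouring of `(ZMod r) ^ 3` with `r` colours has a point `p` and a choice of
fewer than `r` moves for which the three translates belonging to the letters `0, 1, 2` have the same
colour. Here `x a` moves translate only the point of the letter `a`, by a unit vector, and `k i`
moves translate the points of the two letters `a ≠ i` by the unit vectors of `i` and `a`.

Without such a choice every colour class meets every axis-parallel line in exactly one point, and
the three distances to it sum to zero modulo `r` at every point. Along a line each of the
distances runs through all of `ZMod r`, so that `3 * ∑ t = 0`; but `∑ t = r / 2`. -/
theorem exists_equal_colours {r : ℕ} [NeZero r] (hr : Even r)
    (f : (Fin 3 → ZMod r) → Fin r) :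
    ∃ (x k : Fin 3 → ℕ) (p : Fin 3 → ZMod r), 0 < ∑ i, (x i + k i) ∧ ∑ i, (x i + k i) < r ∧
      ∃ c, ∀ a, f (p + (Pi.single a (x a : ZMod r) +
        ∑ i ∈ univ.erase a, (k i : ZMod r) • (Pi.single i 1 + Pi.single a 1))) = c := by
  classical
  by_contra hno
  push Not at hno
  have hr0 := NeZero.pos r
  have hline : ∀ q i, Function.Bijective
      fun t : ZMod r => f (q + (Pi.single i t : Fin 3 → ZMod r)) := by
    intro q i
    rw [Fintype.bijective_iff_injective_and_card]
    refine ⟨fun s t hst => ?_, by simp⟩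
    by_contra hne
    have hne' : t - s ≠ 0 := sub_ne_zero.2 (Ne.symm hne)
    have hx : ∑ j, ((Pi.single i (t - s).val : Fin 3 → ℕ) j + (0 : Fin 3 → ℕ) j)
        = (t - s).val := by simp
    obtain ⟨a, ha⟩ := hno (Pi.single i (t - s).val) 0 (q + Pi.single i s)
      (by rw [hx]; exact Nat.pos_of_ne_zero (by simpa using hne'))
      (by rw [hx]; exact ZMod.val_lt _) (f (q + Pi.single i s))
    apply ha
    rcases eq_or_ne a i with rfl | hai
    · have : (q + Pi.single a s + (Pi.single a ((t - s : ZMod r)))) = q + Pi.single a t := by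
        rw [add_assoc, ← Pi.single_add]; congr 2; ring
      simp [this, ← hst]
    · simp [hai]
  let κ : Fin r := ⟨0, hr0⟩
  -- `T i q` is the distance from `q` to the class of `κ` along the axis `i`.
  choose T hT' using fun i q => (hline q i).2 κ
  have hT : ∀ i q, f (q + (Pi.single i (T i q) : Fin 3 → ZMod r)) = κ := hT'
  have hTu : ∀ i q t, f (q + (Pi.single i t : Fin 3 → ZMod r)) = κ → t = T i q := fun i q t h =>
    (hline q i).1 (h.trans (hT i q).symm)
  have hTκ : ∀ i q, T i q = 0 ↔ f q = κ := by
    intro i q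
    constructor
    · intro h; have := hT i q; rw [h] at this; simpa using this
    · intro h; exact (hTu i q 0 (by simpa using h)).symm
  have hTφ : ∀ i j q, i ≠ j → T i (q + Pi.single i (T i q) + Pi.single j (T j q)) = - T i q ∧
      T j (q + Pi.single i (T i q) + Pi.single j (T j q)) = - T j q := by
    intro i j q hij
    constructor
    · refine (hTu _ _ _ ?_).symm
      rw [← hT j q]
      congr 1
      rw [Pi.single_neg]
      abel
    · refine (hTu _ _ _ ?_).symm
      rw [← hT i q]
      congr 1
      rw [Pi.single_neg]
      abel
  let Q := {q : Fin 3 → ZMod r // f q ≠ κ}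
  let d : Fin 3 → Q → ℕ := fun i q => (T i q.1).val
  have hne : ∀ i (q : Q), T i q.1 ≠ 0 := fun i q h => q.2 ((hTκ i q.1).1 h)
  let φ : Fin 3 → Fin 3 → Q → Q := fun i j q =>
    if hij : i ≠ j then ⟨q.1 + Pi.single i (T i q.1) + Pi.single j (T j q.1), fun h => by
      rw [← hTκ i, (hTφ i j q.1 hij).1, neg_eq_zero] at h
      exact hne i q h⟩ else q
  have hφv : ∀ i j (q : Q), i ≠ j →
      (φ i j q).1 = q.1 + Pi.single i (T i q.1) + Pi.single j (T j q.1) := by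
    intro i j q hij
    simp only [φ, dif_pos hij]
  have hd0 : ∀ i q, 0 < d i q := fun i q => Nat.pos_of_ne_zero (by simpa [d] using hne i q)
  have hdr : ∀ i q, d i q < r := fun i q => ZMod.val_lt _
  have hdT : ∀ i q, ((d i q : ℕ) : ZMod r) = T i q.1 := fun i q => ZMod.natCast_zmod_val _
  have hneg : ∀ i q (t : ZMod r), t = - T i (q : Q).1 → t.val = r - d i q := by
    rintro i q t rfl
    rw [ZMod.neg_val, if_neg (hne i q)]
  -- Otherwise the distances themselves are admissible numbers of moves from `q`.
  have hS : ∀ q, r ≤ d 0 q + d 1 q + d 2 q := by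
    intro q
    by_contra hlt
    have hs : ∑ i, (d i q + (0 : Fin 3 → ℕ) i) = d 0 q + d 1 q + d 2 q := by
      simp [Fin.sum_univ_three]
    obtain ⟨a, ha⟩ := hno (fun i => d i q) 0 q (by rw [hs]; have := hd0 0 q; omega)
      (by rw [hs]; omega) κ
    apply ha
    have := hT a q.1
    simpa [hdT] using this
  -- Otherwise walk backwards along the axis `i`, by `r - d i q` moves of the second kind: they cost
  -- nothing extra, since they also bring the two other letters closer to the colour class.
  have hT2 : ∀ i j k q, i ≠ j → i ≠ k → j ≠ k → r ≤ d i q + d j q → r ≤ d i q + d k q →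
      2 * r ≤ d i q + d j q + d k q := by
    intro i j k q hij hik hjk h1 h2
    by_contra hlt
    have huniv : (univ : Finset (Fin 3)) = {i, j, k} := by
      exact (by decide : ∀ i j k : Fin 3, i ≠ j → i ≠ k → j ≠ k →
        (univ : Finset (Fin 3)) = {i, j, k}) i j k hij hik hjk
    have hi := hdr i q
    have hs : ∀ g : Fin 3 → ℕ, ∑ i, g i = g i + g j + g k := by
      intro g
      rw [huniv, sum_insert (by simp [hij, hik]), sum_insert (by simp [hjk]), sum_singleton,
        add_assoc]
    have hcast : ((r - d i q : ℕ) : ZMod r) = - T i q.1 := by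
      rw [Nat.cast_sub hi.le, hdT]; simp
    obtain ⟨a, ha⟩ := hno
      (fun a => if a = i then 0 else d a q - (r - d i q))
      (Pi.single i (r - d i q)) (q.1 + Pi.single i (T i q.1))
      (by rw [hs]; simp [hij.symm, hik.symm]; omega)
      (by rw [hs]; simp [hij.symm, hik.symm]; omega) κ
    apply ha
    rcases eq_or_ne a i with rfl | hai
    · rw [sum_eq_zero]
      · simpa using hT a q.1
      · intro b hb
        simp [(mem_erase.1 hb).1]
    · rw [sum_eq_single i]
      · have hle : r - d i q ≤ d a q := by
          have : a ∈ ({i, j, k} : Finset (Fin 3)) := huniv ▸ mem_univ a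
          simp only [mem_insert, mem_singleton] at this
          rcases this with rfl | rfl | rfl
          · exact absurd rfl hai
          · omega
          · omega
        simp only [Pi.single_eq_same, if_neg hai, Nat.cast_sub hle, hcast, hdT]
        refine (congrArg f ?_).trans (hT a q.1)
        ext b
        simp only [Pi.add_apply, Pi.smul_apply, smul_eq_mul, Pi.single_apply]
        split_ifs <;> ring
      · intro b _ hb
        simp [hb]
      · intro h
        exact absurd (mem_erase.2 ⟨Ne.symm hai, mem_univ _⟩) h
  have hsum : ∀ q, T 0 q + T 1 q + T 2 q = 0 := by
    intro q
    by_cases hq : f q = κ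
    · simp [(hTκ _ q).2 hq]
    · have := sum_eq_or_eq d φ hd0 hdr ?_ ?_ ?_ hS hT2 ⟨q, hq⟩
      · have h : ((d 0 ⟨q, hq⟩ + d 1 ⟨q, hq⟩ + d 2 ⟨q, hq⟩ : ℕ) : ZMod r) = 0 := by
          rcases this with h | h <;> rw [h] <;> simp
        push_cast [hdT] at h
        exact h
      · intro i j hij q
        apply Subtype.ext
        rw [hφv _ _ _ hij, hφv _ _ _ hij, (hTφ i j q.1 hij).1, (hTφ i j q.1 hij).2,
          Pi.single_neg, Pi.single_neg]
        abel
      · intro i j q hij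
        exact hneg i q _ (by rw [hφv _ _ _ hij, (hTφ i j q.1 hij).1])
      · intro i j q hij
        exact hneg j q _ (by rw [hφv _ _ _ hij, (hTφ i j q.1 hij).2])
  -- Along the first axis each of the three summands runs through all of `ZMod r`.
  have hperm : ∀ j, j ≠ 0 → ∑ t : ZMod r, T j (Pi.single 0 t) = ∑ t : ZMod r, t := by
    intro j hj
    refine Function.Bijective.sum_comp (e := fun t : ZMod r => T j (Pi.single 0 t))
      (Finite.injective_iff_bijective.1 fun s t hst => ?_) id
    have h1 := hT j (Pi.single 0 s)
    have h2 := hT j (Pi.single 0 t)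
    replace hst : T j (Pi.single 0 s) = T j (Pi.single 0 t) := hst
    rw [hst] at h1
    rw [add_comm] at h1 h2
    exact (hline _ 0).1 (h1.trans h2.symm)
  have hperm0 : ∑ t : ZMod r, T 0 (Pi.single 0 t) = ∑ t : ZMod r, t := by
    have : ∀ t, T 0 (Pi.single 0 t) = T 0 0 - t := by
      intro t
      refine (hTu _ _ _ ?_).symm
      rw [← Pi.single_add, add_sub_cancel]
      simpa using hT 0 0
    simp only [this]
    exact Equiv.sum_comp (Equiv.subLeft (T 0 0)) id
  have h3 := sum_congr rfl fun (t : ZMod r) (_ : t ∈ univ) => hsum (Pi.single 0 t)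
  rw [sum_add_distrib, sum_add_distrib, hperm0, hperm 1 (by decide), hperm 2 (by decide),
    sum_const_zero] at h3
  have h4 : ∑ t : ZMod r, t = - ∑ t : ZMod r, t := by
    rw [← sum_neg_distrib]
    exact (Equiv.sum_comp (Equiv.neg (ZMod r)) id).symm
  have h5 : ∑ t : ZMod r, t = 0 := by
    linear_combination h3 - h4
  exact sum_zmod_ne_zero hr h5

end

/-! ### Existence of lines with fewer than `r` intervals -/

section

open Finset Filter

theorem not_isReducedColouring {r : ℕ} (hr : 2 ≤ r) (heven : Even r) (c : List (Fin 3) → Fin r) :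
    ¬ IsReducedColouring c := by
  intro hc
  have : NeZero r := ⟨by omega⟩
  obtain ⟨x, k, p, h0, hr, d, hd⟩ :=
    exists_equal_colours heven (stateColour c (wordPow r basicWord))
  obtain ⟨U, hU, hV⟩ := (isConfiguration_sum hc x k).append
    (isConfiguration_zero c (r - ∑ i, (x i + k i)))
  obtain ⟨a, ha⟩ := IsSubstitution.not_mono hc (hU.append (isSubstitution_const c
    (reserve r 0 (p 0).val ++ reserve r 1 (p 1).val ++ reserve r 2 (p 2).val)))
    (by omega) (by omega) d
  apply ha
  have hVa := hV a [] [] p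
  rw [Nat.add_sub_cancel' hr.le] at hVa
  simp only [List.nil_append, List.append_nil] at hVa
  rw [← hd a]
  refine hVa.trans ?_
  -- Only the translation vectors of the two descriptions remain to be compared.
  congr 2
  rw [add_zero, ← add_sum_erase _ _ (mem_univ a), Pi.add_apply, Finset.sum_apply]
  congr 1
  · ext b
    simp [Pi.single_apply]
  · refine sum_congr rfl fun i hi => ?_
    have hia : a ≠ i := (mem_erase.1 hi).1.symm
    ext b
    simp [hia]

/-- A sequence of counterexamples of unbounded lengths would have a limit colour along an
ultrafilter, which is a reduced colouring. -/
theorem exists_forcesFoldLine {r : ℕ} (hr : 2 ≤ r) (heven : Even r) :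
    ∃ N : ℕ, ∀ n : ℕ, N ≤ n → ForcesFoldLine 3 r (r - 1) n := by
  by_contra hcon
  push Not at hcon
  have hfreq : ∃ᶠ n in atTop, ¬ ForcesFoldLine 3 r (r - 1) n :=
    frequently_atTop.2 fun N => by
      obtain ⟨n, hn, h⟩ := hcon N
      exact ⟨n, hn, h⟩
  have : (atTop ⊓ 𝓟 {n | ¬ ForcesFoldLine 3 r (r - 1) n}).NeBot :=
    frequently_mem_iff_neBot.1 hfreq
  let U := Ultrafilter.of (atTop ⊓ 𝓟 {n | ¬ ForcesFoldLine 3 r (r - 1) n})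
  have hU : (U : Filter ℕ) ≤ atTop := (Ultrafilter.of_le _).trans inf_le_left
  have hbad : ∀ᶠ n in U, ¬ ForcesFoldLine 3 r (r - 1) n :=
    (Ultrafilter.of_le _).trans inf_le_right (mem_principal_self _)
  have hC : ∀ n, ∃ C : (Fin n → Fin 3) → Fin r, ¬ ForcesFoldLine 3 r (r - 1) n →
      ∀ l : Combinatorics.Line (Fin 3) (Fin n), l.IsMono C → ¬ IsFold (r - 1) l := by
    intro n
    by_cases h : ForcesFoldLine 3 r (r - 1) n
    · exact ⟨fun _ => ⟨0, by omega⟩, fun h' => absurd h h'⟩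
    · unfold ForcesFoldLine at h
      push Not at h
      obtain ⟨C, hC⟩ := h
      exact ⟨C, fun _ => hC⟩
  choose C hC using hC
  refine not_isReducedColouring hr heven (limitColour U C)
    ⟨fun a u v => limitColour_merge hU C a u v, fun l h0 hlr k => ?_⟩
  exact limitColour_not_mono hU C (hbad.mono hC) l h0 (by omega) k

end

end HalesJewettIntervals

theorem theorem1 (r : ℕ) (hr : 2 ≤ r) (heven : Even r) :
    (∃ N : ℕ, ∀ n : ℕ, N ≤ n → HalesJewettIntervals.ForcesFoldLine 3 r (r - 1) n) ∧
      HalesJewettIntervals.IsIntervalNumber 3 r (r - 1) := by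
  have h := HalesJewettIntervals.exists_forcesFoldLine hr heven
  refine ⟨h, ⟨by omega, h⟩, ?_⟩
  rintro p ⟨-, N, hN⟩
  by_contra hp
  exact HalesJewettIntervals.not_forcesFoldLine (Nat.Even.sub_odd (by omega) heven odd_one)
    (Nat.sub_le r 1) (not_le.1 hp) (hN N le_rfl)
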